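/- Let $R$ be an associative ring with unity (not necessarily commutative). Call a ring right (respectively left) quasi-duo if each of its maximal right (respectively left) ideals is a two-sided ideal. Let $R[x]$ and $R[x,x^{-1}]$ be the ordinary polynomial ring and Laurent polynomial ring over $R$, in which $x$ commutes with the elements of $R$. Let $J(\cdot)$ denote the Jacobson radical, let $\mathcal{N}(R)$ be the nil radical of $R$, i.e. the sum of all nil two-sided ideals of $R$, and let $\mathcal{N}(R)[x]$ be the set of polynomials in $R[x]$ all of whose coefficients lie in $\mathcal{N}(R)$. Then the following hold. (1) $R[x]$ is right quasi-duo if and only if $R[x,x^{-1}]$ is right quasi-duo, if and only if $J(R[x])=\mathcal{N}(R)[x]$ and the factor ring $R/\mathcal{N}(R)$ is commutative. (2) $R[x]$ is left quasi-duo if and only if $R[x,x^{-1}]$ is left quasi-duo, if and only if $J(R[x])=\mathcal{N}(R)[x]$ and the factor ring $R/\mathcal{N}(R)$ is commutative. (3) Consequently, $R[x]$ is right quasi-duo if and only if $R[x]$ is left quasi-duo, if and only if the factor ring $R[x]/J(R[x])$ is commutative. -/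

import Mathlib

open scoped Polynomial LaurentPolynomial

/-- A ring is right quasi-duo if every maximal right ideal is two-sided. Right ideals of `R` are
the submodules of `R` over the opposite ring. -/
def IsRightQuasiDuo (R : Type*) [Ring R] : Prop :=
  ∀ M : Submodule Rᵐᵒᵖ R, IsCoatom M → ∀ r x : R, x ∈ M → r * x ∈ M

/-- A ring is left quasi-duo if every maximal left ideal is two-sided. Left ideals of `R` are
the terms of `Ideal R`. -/
def IsLeftQuasiDuo (R : Type*) [Ring R] : Prop :=
  ∀ M : Ideal R, M.IsMaximal → ∀ x r : R, x ∈ M → x * r ∈ M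

/-- The (upper) nil radical of a ring: the sum of all its nil two-sided ideals. -/
def upperNilRadical (R : Type*) [Ring R] : Ideal R :=
  sSup {I : Ideal R | I.IsTwoSided ∧ ∀ a ∈ I, IsNilpotent a}

instance upperNilRadical.isTwoSided (R : Type*) [Ring R] : (upperNilRadical R).IsTwoSided where
  mul_mem_of_left := by
    intro a b ha
    have h : upperNilRadical R ≤
        Submodule.comap (LinearMap.toSpanSingleton R R b) (upperNilRadical R) := by
      refine sSup_le fun I hI x hx => ?_
      have := hI.1
      exact (le_sSup hI : I ≤ upperNilRadical R) (I.mul_mem_right b hx)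
    exact h ha

/-- For a left ideal `I` of `R`, the left ideal `I[x]` of `R[x]` of all polynomials whose
coefficients all lie in `I`. -/
def polynomialsWithCoeffsIn {R : Type*} [Ring R] (I : Ideal R) : Ideal R[X] where
  carrier := {f | ∀ n, f.coeff n ∈ I}
  add_mem' hf hg n := by
    rw [Polynomial.coeff_add]
    exact I.add_mem (hf n) (hg n)
  zero_mem' n := by
    rw [Polynomial.coeff_zero]
    exact I.zero_mem
  smul_mem' p f hf n := by
    rw [smul_eq_mul, Polynomial.coeff_mul]
    exact I.sum_mem fun ij _ => I.mul_mem_left _ (hf ij.2)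

/-! ### One-sided inverses and left-right symmetry of the Jacobson radical -/

section Jacobson

variable {S : Type*} [Ring S]

/-! Every condition reduces to commutativity of `S` modulo `J(S)`, for `S` the polynomial or the
Laurent ring. That property is left-right symmetric and implies quasi-duo, since maximal one-sided
ideals contain `J(S)`. Conversely, maximal left ideals of a left quasi-duo ring are completely
prime, so nilpotents lie in `J(S)`; it remains to see that commutators of `R` are nilpotent.

This is `IsLeftQuasiDuo.isNilpotent_commutator`. If `u` is not nilpotent, `1 - uX` lies in a maximal
left ideal `M`, and commuting it past `r` puts `[u, r]` in `M`. For a non-nilpotent `c = [a, b]`,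
two such ideals, for `c` and then for `ca`, contradict each other. Right-handed versions come from
opposite rings.

Then `J(S) ∩ R` is the set of nilpotents, hence `N(R)`. Units over the commutative ring `R/N(R)`
give `J(R[x]) ⊆ N(R)[x]`. Left inverses descend from Laurent to ordinary polynomials; Nakayama over
`R[T + T⁻¹]` goes back. -/

theorem Ring.mem_jacobson_iff_exists_left_inverse {x : S} :
    x ∈ Ring.jacobson S ↔ ∀ y, ∃ z, z * (1 - y * x) = 1 := by
  rw [← Ideal.jacobson_bot, Ideal.mem_jacobson_iff]
  refine ⟨fun h y => ?_, fun h y => ?_⟩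
  · obtain ⟨z, hz⟩ := h (-y)
    refine ⟨z, ?_⟩
    rw [Ideal.mem_bot, sub_eq_zero] at hz
    refine Eq.trans ?_ hz
    noncomm_ring
  · obtain ⟨z, hz⟩ := h (-y)
    refine ⟨z, ?_⟩
    rw [Ideal.mem_bot, sub_eq_zero, ← hz]
    noncomm_ring

/-- A left inverse `z` of `1 - x` equals `1 + z * x`, so it has a left inverse of its own and is a
unit. -/
theorem Ring.isUnit_one_sub_of_mem_jacobson {x : S} (hx : x ∈ Ring.jacobson S) :
    IsUnit (1 - x) := by
  obtain ⟨z, hz⟩ := Ring.mem_jacobson_iff_exists_left_inverse.1 hx 1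
  rw [one_mul] at hz
  have hz' : z = 1 - (-z) * x := by
    have : z - z * x = 1 := by rw [← hz]; noncomm_ring
    rw [neg_mul, sub_neg_eq_add, ← this]; abel
  obtain ⟨w, hw⟩ := Ring.mem_jacobson_iff_exists_left_inverse.1 hx (-z)
  rw [← hz'] at hw
  have hwx : w = 1 - x := by
    calc w = w * (z * (1 - x)) := by rw [hz, mul_one]
      _ = 1 - x := by rw [← mul_assoc, hw, one_mul]
  exact ⟨⟨1 - x, z, hwx ▸ hw, hz⟩, rfl⟩

theorem Ring.op_mem_jacobson {x : S} (hx : x ∈ Ring.jacobson S) :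
    MulOpposite.op x ∈ Ring.jacobson Sᵐᵒᵖ := by
  rw [Ring.mem_jacobson_iff_exists_left_inverse]
  intro y
  have h := Ring.isUnit_one_sub_of_mem_jacobson ((Ring.jacobson S).mul_mem_right y.unop hx)
  obtain ⟨u, hu⟩ := h
  refine ⟨MulOpposite.op ↑u⁻¹, MulOpposite.unop_injective ?_⟩
  simp only [MulOpposite.unop_mul, MulOpposite.unop_sub, MulOpposite.unop_one,
    MulOpposite.unop_op]
  rw [← hu, Units.mul_inv]

theorem Ring.mem_jacobson_of_op_mem {x : S} (hx : MulOpposite.op x ∈ Ring.jacobson Sᵐᵒᵖ) :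
    x ∈ Ring.jacobson S := by
  rw [Ring.mem_jacobson_iff_exists_left_inverse]
  intro y
  have h := Ring.isUnit_one_sub_of_mem_jacobson
    ((Ring.jacobson Sᵐᵒᵖ).mul_mem_right (MulOpposite.op y) hx)
  obtain ⟨u, hu⟩ := h
  refine ⟨(↑u⁻¹ : Sᵐᵒᵖ).unop, MulOpposite.op_injective ?_⟩
  have := u.mul_inv
  rw [hu] at this
  simpa using this

end Jacobson

/-! ### Quasi-duo rings and commutativity modulo the radical -/

section QuasiDuo

variable {S : Type*} [Ring S]

/-- Commutators lie in the Jacobson radical, that is, `S ⧸ Ring.jacobson S` is commutative. -/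
def IsCommModJacobson (S : Type*) [Ring S] : Prop :=
  ∀ f g : S, f * g - g * f ∈ Ring.jacobson S

theorem IsCommModJacobson.op (h : IsCommModJacobson S) : IsCommModJacobson Sᵐᵒᵖ := fun f g => by
  have := Ring.op_mem_jacobson (h g.unop f.unop)
  simpa using this

theorem IsCommModJacobson.isLeftQuasiDuo (h : IsCommModJacobson S) : IsLeftQuasiDuo S := by
  intro M hM x r hx
  have h1 := Ring.jacobson_le_of_isMaximal M (h x r)
  have h2 := M.add_mem h1 (M.mul_mem_left r hx)
  rwa [sub_add_cancel] at h2

theorem isRightQuasiDuo_iff_op : IsRightQuasiDuo S ↔ IsLeftQuasiDuo Sᵐᵒᵖ := by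
  let e : S ≃ₗ[Sᵐᵒᵖ] Sᵐᵒᵖ :=
    { MulOpposite.opAddEquiv with
      map_smul' := fun r x => MulOpposite.unop_injective rfl }
  have he : ∀ x, e x = MulOpposite.op x := fun _ => rfl
  let o := Submodule.orderIsoMapComap e
  constructor
  · intro h M hM x r hx
    have hc : IsCoatom (o.symm M) := (OrderIso.isCoatom_iff o.symm M).2 (Ideal.isMaximal_def.1 hM)
    exact h (o.symm M) hc r.unop x.unop hx
  · intro h M hM r x hx
    have hc : IsCoatom (o M) := (OrderIso.isCoatom_iff o M).2 hM
    have := h (o M) (Ideal.isMaximal_def.2 hc) (MulOpposite.op x) (MulOpposite.op r)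
      ⟨x, hx, rfl⟩
    obtain ⟨y, hy, hxy⟩ := this
    have : y = r * x := MulOpposite.op_injective hxy
    exact this ▸ hy

theorem IsCommModJacobson.isRightQuasiDuo (h : IsCommModJacobson S) : IsRightQuasiDuo S :=
  isRightQuasiDuo_iff_op.2 h.op.isLeftQuasiDuo

/-- If `x ∉ M`, multiply a relation `t * x + i = 1` with `i ∈ M` by `y` on the right; two-sidedness
keeps `i * y` in `M`. -/
theorem IsLeftQuasiDuo.mem_or_mem (h : IsLeftQuasiDuo S) {M : Ideal S} (hM : M.IsMaximal)
    {x y : S} (hxy : x * y ∈ M) : x ∈ M ∨ y ∈ M := by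
  by_contra! hn
  obtain ⟨t, i, hi, ht⟩ := hM.exists_inv hn.1
  apply hn.2
  have h1 : (t * x + i) * y ∈ M := by
    rw [add_mul, mul_assoc]
    exact M.add_mem (M.mul_mem_left _ hxy) (h M hM _ _ hi)
  rwa [ht, one_mul] at h1

theorem IsLeftQuasiDuo.mem_jacobson_of_isNilpotent (h : IsLeftQuasiDuo S) {x : S}
    (hx : IsNilpotent x) : x ∈ Ring.jacobson S := by
  rw [Ring.jacobson_eq_sInf_isMaximal, Submodule.mem_sInf]
  intro M hM
  obtain ⟨n, hn⟩ := hx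
  have : x ^ n ∈ M := hn ▸ M.zero_mem
  clear hn
  induction n with
  | zero => exact absurd ((Ideal.eq_top_iff_one M).2 (by simpa using this)) hM.ne_top
  | succ n ih =>
    rw [pow_succ] at this
    exact (h.mem_or_mem hM this).elim ih id

end QuasiDuo

/-! ### Left inverses of polynomials and Laurent polynomials -/

section LeftInverses

open Polynomial

variable {R : Type*} [Ring R]

/-- For positive exponent the constant term of `g` is killed by a unit, so `X` divides `g` and can
be cancelled. -/
theorem Polynomial.exists_left_inverse_of_mul_eq_X_pow {f : R[X]} (hf : IsUnit (f.coeff 0))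
    (n : ℕ) {g : R[X]} (h : g * f = X ^ n) : ∃ g', g' * f = 1 := by
  induction n generalizing g with
  | zero => exact ⟨g, by rw [h, pow_zero]⟩
  | succ n ih =>
    have h0 : g.coeff 0 = 0 := by
      have := congrArg (fun p => coeff p 0) h
      simp only [mul_coeff_zero, coeff_X_pow] at this
      exact (hf.mul_left_eq_zero).1 (by simpa using this)
    obtain ⟨g', rfl⟩ := X_dvd_iff.2 h0
    refine ih (g := g') ?_
    have hX : (g' * f) * X = X ^ n * X := by
      rw [← X_mul, ← mul_assoc, h, pow_succ]
    ext i
    simpa using congrArg (fun p => coeff p (i + 1)) hX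

theorem LaurentPolynomial.exists_left_inverse_of_mul_toLaurent_eq_one {f : R[X]}
    (hf : IsUnit (f.coeff 0)) {g : R[T;T⁻¹]} (h : g * toLaurent f = 1) :
    ∃ g' : R[X], g' * f = 1 := by
  obtain ⟨n, p, hp⟩ := g.exists_T_pow
  refine Polynomial.exists_left_inverse_of_mul_eq_X_pow hf n (g := p) ?_
  apply toLaurent_injective
  rw [map_mul, hp, mul_assoc, LaurentPolynomial.T_mul, ← mul_assoc, h, one_mul, toLaurent_X_pow]

theorem Polynomial.isNilpotent_of_mul_one_sub_C_mul_X {a : R} {g : R[X]}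
    (h : g * (1 - C a * X) = 1) : IsNilpotent a := by
  -- The inverse must be the geometric series; being a polynomial, it terminates.
  have key : ∀ n, g.coeff n = a ^ n := by
    intro n
    induction n with
    | zero =>
      have := congrArg (fun p => coeff p 0) h
      simpa [mul_sub] using this
    | succ n ih =>
      have := congrArg (fun p => coeff p (n + 1)) h
      simp only [mul_sub, mul_one, coeff_sub, ← mul_assoc, coeff_mul_X, coeff_mul_C, ih,
        coeff_one] at this
      rw [if_neg (Nat.succ_ne_zero n), sub_eq_zero] at this
      rw [this, pow_succ]
  exact ⟨g.natDegree + 1, by rw [← key, coeff_eq_zero_of_natDegree_lt (Nat.lt_succ_self _)]⟩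

theorem LaurentPolynomial.isNilpotent_of_mul_one_sub_C_mul_T {a : R} {g : R[T;T⁻¹]}
    (h : g * (1 - LaurentPolynomial.C a * LaurentPolynomial.T 1) = 1) : IsNilpotent a := by
  obtain ⟨g', hg'⟩ := LaurentPolynomial.exists_left_inverse_of_mul_toLaurent_eq_one
    (f := 1 - Polynomial.C a * X) (g := g) (by simp) (by simpa using h)
  exact Polynomial.isNilpotent_of_mul_one_sub_C_mul_X hg'

end LeftInverses

/-! ### Nilpotency of commutators -/

section Commutators

variable {R S : Type*} [Ring R] [Ring S]

/-- Reducing modulo `P` kills the second ideal and makes `1 - āT` left invertible, so `ā` is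
nilpotent. The map `j` lets one argument serve polynomial rings, Laurent rings and their opposites.
-/
theorem exists_pow_mem_of_one_mem_sup {ι : R →+* S} {X : S} {j : S →+* R[T;T⁻¹]}
    (hjι : ∀ r, j (ι r) = LaurentPolynomial.C r) (hjX : j X = LaurentPolynomial.T 1)
    (P : Ideal R) [P.IsTwoSided] (a : R)
    (h : (1 : S) ∈ Ideal.span {1 - ι a * X} ⊔ Ideal.span (ι '' P)) : ∃ n, a ^ n ∈ P := by
  let π : S →+* (R ⧸ P)[T;T⁻¹] :=
    (AddMonoidAlgebra.mapRingHom ℤ (Ideal.Quotient.mk P)).comp j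
  have hπι : ∀ r, π (ι r) = LaurentPolynomial.C (Ideal.Quotient.mk P r) := fun r => by
    simp only [π, RingHom.comp_apply, hjι]
    exact AddMonoidAlgebra.mapRingHom_single _ _ _
  have hπX : π X = LaurentPolynomial.T 1 := by
    simp only [π, RingHom.comp_apply, hjX]
    exact (AddMonoidAlgebra.mapRingHom_single _ _ _).trans (by rw [map_one]; rfl)
  obtain ⟨p, hp, q, hq, hpq⟩ := Submodule.mem_sup.1 h
  obtain ⟨g, rfl⟩ := Ideal.mem_span_singleton'.1 hp
  have hq0 : π q = 0 := by
    have hle : Ideal.span (ι '' P) ≤ RingHom.ker π := by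
      rw [Ideal.span_le]
      rintro _ ⟨r, hr, rfl⟩
      change π (ι r) = 0
      rw [hπι, Ideal.Quotient.eq_zero_iff_mem.2 hr, map_zero]
    exact hle hq
  have h1 := congrArg π hpq
  rw [map_add, hq0, add_zero, map_mul, map_sub, map_mul, hπι, hπX, map_one] at h1
  obtain ⟨n, hn⟩ := LaurentPolynomial.isNilpotent_of_mul_one_sub_C_mul_T h1
  exact ⟨n, Ideal.Quotient.eq_zero_iff_mem.1 (by rwa [map_pow])⟩

theorem IsLeftQuasiDuo.isNilpotent_commutator (hS : IsLeftQuasiDuo S) {ι : R →+* S} {X : S}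
    {j : S →+* R[T;T⁻¹]} (hX : ∀ s, Commute X s)
    (hjι : ∀ r, j (ι r) = LaurentPolynomial.C r) (hjX : j X = LaurentPolynomial.T 1) (a b : R) :
    IsNilpotent (a * b - b * a) := by
  set c := a * b - b * a with hc
  by_contra hnil
  have hcomm : ∀ u r : R, ι r * (1 - ι u * X) - (1 - ι u * X) * ι r = ι (u * r - r * u) * X := by
    intro u r
    have := (hX (ι r)).eq
    rw [mul_sub, sub_mul, mul_assoc (ι u), this, map_sub, map_mul, map_mul]
    noncomm_ring
  have hone : ∀ {M : Ideal S}, M.IsMaximal → (1 : S) ∉ M := fun hM h =>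
    hM.ne_top ((Ideal.eq_top_iff_one _).2 h)
  have hι : ∀ {M : Ideal S}, M.IsMaximal → ∀ u, 1 - ι u * X ∈ M → ι u ∉ M ∧ X ∉ M := by
    intro M hM u hu
    refine ⟨fun h => hone hM ?_, fun h => hone hM ?_⟩
    · simpa using M.add_mem hu (hS M hM _ X h)
    · simpa using M.add_mem hu (M.mul_mem_left (ι u) h)
  -- Modulo `M`, `u` is inverse to the central element `X`, so it commutes with the image of `R`.
  have hcentral : ∀ {M : Ideal S}, M.IsMaximal → ∀ u, 1 - ι u * X ∈ M → ∀ r,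
      ι (u * r - r * u) ∈ M := by
    intro M hM u hu r
    refine (hS.mem_or_mem hM (y := X) ?_).resolve_right (hι hM u hu).2
    rw [← hcomm]
    exact M.sub_mem (M.mul_mem_left _ hu) (hS M hM _ _ hu)
  have h1 : Ideal.span {1 - ι c * X} ≠ ⊤ := by
    intro h
    obtain ⟨n, hn⟩ := exists_pow_mem_of_one_mem_sup hjι hjX ⊥ c (by rw [h]; simp)
    exact hnil ⟨n, hn⟩
  obtain ⟨M, hM, hcM⟩ := Ideal.exists_le_maximal _ h1
  replace hcM : 1 - ι c * X ∈ M := hcM (Ideal.mem_span_singleton_self _)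
  let P : Ideal R := M.comap ι
  have hP : P.IsTwoSided := ⟨fun {x} r hx => by
    change ι (x * r) ∈ M
    rw [map_mul]
    exact hS M hM _ _ hx⟩
  have hPprime : ∀ {x y : R}, x * y ∈ P → x ∈ P ∨ y ∈ P := by
    intro x y hxy
    change ι (x * y) ∈ M at hxy
    rw [map_mul] at hxy
    exact hS.mem_or_mem hM hxy
  have hcP : c ∉ P := (hι hM c hcM).1
  have haP : a ∉ P := fun h => hcP (P.sub_mem (P.mul_mem_right b h) (P.mul_mem_left b h))
  have hcaP : ∀ n, (c * a) ^ n ∉ P := by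
    intro n
    induction n with
    | zero =>
      intro h
      rw [pow_zero] at h
      exact hcP (by simpa using P.mul_mem_left c h)
    | succ n ih =>
      rw [pow_succ]
      exact fun h => (hPprime h).elim ih fun h => (hPprime h).elim hcP haP
  -- The second maximal ideal must also contain `P`, so that `[c, b]`, which lies in `M`, vanishes
  -- modulo it.
  have h2 : Ideal.span {1 - ι (c * a) * X} ⊔ Ideal.span (ι '' P) ≠ ⊤ := by
    intro h
    obtain ⟨n, hn⟩ := exists_pow_mem_of_one_mem_sup hjι hjX P (c * a) (by rw [h]; simp)
    exact hcaP n hn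
  obtain ⟨M', hM', hle⟩ := Ideal.exists_le_maximal _ h2
  have hcaM' : 1 - ι (c * a) * X ∈ M' :=
    hle (Ideal.mem_sup_left (Ideal.mem_span_singleton_self _))
  have hPM' : ∀ r ∈ P, ι r ∈ M' := fun r hr =>
    hle (Ideal.mem_sup_right (Ideal.subset_span ⟨r, hr, rfl⟩))
  have hcc : ι (c * c) ∈ M' := by
    -- This is the Leibniz rule `[ca, b] = c[a, b] + [c, b]a` with `[a, b] = c`.
    have e : c * c = (c * a * b - b * (c * a)) - (c * b - b * c) * a := by
      nth_rewrite 2 [hc]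
      noncomm_ring
    rw [e, map_sub]
    exact M'.sub_mem (hcentral hM' _ hcaM' b)
      (hPM' _ (P.mul_mem_right a (hcentral hM c hcM b)))
  rw [map_mul] at hcc
  have hcM' : ι c ∈ M' := (hS.mem_or_mem hM' hcc).elim id id
  refine (hι hM' _ hcaM').1 ?_
  rw [map_mul]
  exact hS M' hM' _ _ hcM'

end Commutators

/-! ### Quasi-duo is equivalent to commutativity modulo the radical -/

section Criteria

variable {R : Type*} [Ring R]

/-- As `X` is central, a commutator of monomials is `C [a, b]` times a power of `X`; the rest is
additivity. -/
theorem Polynomial.isCommModJacobson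
    (h : ∀ a b : R, Polynomial.C (a * b - b * a) ∈ Ring.jacobson R[X]) :
    IsCommModJacobson R[X] := by
  have key : ∀ (a b : R) (m n : ℕ), Polynomial.monomial m a * Polynomial.monomial n b -
      Polynomial.monomial n b * Polynomial.monomial m a ∈ Ring.jacobson R[X] := by
    intro a b m n
    have := (Ring.jacobson R[X]).mul_mem_right (Polynomial.X ^ (m + n)) (h a b)
    rwa [Polynomial.C_mul_X_pow_eq_monomial, map_sub, ← Polynomial.monomial_mul_monomial,
      add_comm, ← Polynomial.monomial_mul_monomial] at this
  intro f g
  induction f using Polynomial.induction_on' with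
  | add p q hp hq =>
    have := (Ring.jacobson R[X]).add_mem hp hq
    convert! this using 1
    noncomm_ring
  | monomial m a =>
    induction g using Polynomial.induction_on' with
    | add p q hp hq =>
      have := (Ring.jacobson R[X]).add_mem hp hq
      convert! this using 1
      noncomm_ring
    | monomial n b => exact key a b m n

theorem LaurentPolynomial.isCommModJacobson
    (h : ∀ a b : R, LaurentPolynomial.C (a * b - b * a) ∈ Ring.jacobson R[T;T⁻¹]) :
    IsCommModJacobson R[T;T⁻¹] := by
  have key : ∀ (a b : R) (m n : ℤ), (C a * T m) * (C b * T n) - (C b * T n) * (C a * T m) ∈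
      Ring.jacobson R[T;T⁻¹] := by
    intro a b m n
    have hmul : ∀ (a b : R) (m n : ℤ), (C a * T m) * (C b * T n) = C (a * b) * T (m + n) := by
      intro a b m n
      rw [mul_assoc, ← mul_assoc (T m), T_mul, mul_assoc, ← T_add, map_mul, mul_assoc]
    have := (Ring.jacobson R[T;T⁻¹]).mul_mem_right (T (m + n)) (h a b)
    rwa [map_sub, sub_mul, ← hmul, add_comm, ← hmul] at this
  intro f g
  induction f using LaurentPolynomial.induction_on' with
  | add p q hp hq =>
    have := (Ring.jacobson R[T;T⁻¹]).add_mem hp hq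
    convert! this using 1
    noncomm_ring
  | C_mul_T m a =>
    induction g using LaurentPolynomial.induction_on' with
    | add p q hp hq =>
      have := (Ring.jacobson R[T;T⁻¹]).add_mem hp hq
      convert! this using 1
      noncomm_ring
    | C_mul_T n b => exact key a b _ _

theorem Polynomial.isLeftQuasiDuo_iff : IsLeftQuasiDuo R[X] ↔ IsCommModJacobson R[X] := by
  refine ⟨fun h => Polynomial.isCommModJacobson fun a b => h.mem_jacobson_of_isNilpotent ?_,
    IsCommModJacobson.isLeftQuasiDuo⟩
  exact (h.isNilpotent_commutator (ι := Polynomial.C) (j := Polynomial.toLaurent)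
    Polynomial.commute_X Polynomial.toLaurent_C Polynomial.toLaurent_X a b).map Polynomial.C

theorem LaurentPolynomial.isLeftQuasiDuo_iff :
    IsLeftQuasiDuo R[T;T⁻¹] ↔ IsCommModJacobson R[T;T⁻¹] := by
  refine ⟨fun h => LaurentPolynomial.isCommModJacobson
    fun a b => h.mem_jacobson_of_isNilpotent ?_, IsCommModJacobson.isLeftQuasiDuo⟩
  exact (h.isNilpotent_commutator (ι := C) (j := RingHom.id _)
    (commute_T 1) (fun _ => rfl) rfl a b).map C

theorem Polynomial.isRightQuasiDuo_iff : IsRightQuasiDuo R[X] ↔ IsCommModJacobson R[X] := by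
  refine ⟨fun h => Polynomial.isCommModJacobson fun a b => Ring.mem_jacobson_of_op_mem ?_,
    IsCommModJacobson.isRightQuasiDuo⟩
  rw [isRightQuasiDuo_iff_op] at h
  -- Multiplication reverses under `op`, so the commutator of `op b` and `op a` is `op (a * b - b *
  -- a)`.
  have hnil := h.isNilpotent_commutator (R := Rᵐᵒᵖ) (ι := Polynomial.C.op)
    (j := Polynomial.toLaurent.comp (Polynomial.opRingEquiv R).toRingHom)
    (X := MulOpposite.op Polynomial.X)
    (fun s => (Polynomial.commute_X s.unop).op)
    (fun r => by simp) (by simp) (MulOpposite.op b) (MulOpposite.op a)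
  exact h.mem_jacobson_of_isNilpotent (hnil.map Polynomial.C.op)

/-- The opposite of a Laurent polynomial ring is the Laurent polynomial ring over the opposite
ring. -/
noncomputable def LaurentPolynomial.opRingHom (R : Type*) [Ring R] :
    R[T;T⁻¹]ᵐᵒᵖ →+* Rᵐᵒᵖ[T;T⁻¹] :=
  (AddMonoidAlgebra.mapDomainRingHom Rᵐᵒᵖ
    { toFun := AddOpposite.unop
      map_zero' := rfl
      map_add' := fun a b => add_comm b.unop a.unop }).comp
    AddMonoidAlgebra.opRingEquiv.toRingHom

theorem LaurentPolynomial.opRingHom_op_single (n : ℤ) (r : R) :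
    LaurentPolynomial.opRingHom R (MulOpposite.op (AddMonoidAlgebra.single n r)) =
      AddMonoidAlgebra.single n (MulOpposite.op r) := by
  refine (congrArg (AddMonoidAlgebra.mapDomainRingHom Rᵐᵒᵖ _)
    (AddMonoidAlgebra.opRingEquiv_single r n)).trans ?_
  rw [AddMonoidAlgebra.mapDomainRingHom_apply, AddMonoidAlgebra.mapDomain_single]
  rfl

theorem LaurentPolynomial.isRightQuasiDuo_iff :
    IsRightQuasiDuo R[T;T⁻¹] ↔ IsCommModJacobson R[T;T⁻¹] := by
  refine ⟨fun h => LaurentPolynomial.isCommModJacobson fun a b => Ring.mem_jacobson_of_op_mem ?_,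
    IsCommModJacobson.isRightQuasiDuo⟩
  rw [isRightQuasiDuo_iff_op] at h
  have hnil := h.isNilpotent_commutator (R := Rᵐᵒᵖ) (ι := C.op) (j := opRingHom R)
    (X := MulOpposite.op (T 1)) (fun s => (commute_T 1 s.unop).op)
    (fun r => opRingHom_op_single 0 r.unop) (opRingHom_op_single 1 1)
    (MulOpposite.op b) (MulOpposite.op a)
  exact h.mem_jacobson_of_isNilpotent (hnil.map C.op)

end Criteria

/-! ### The radical of `R[x]` and the nil radical of `R` -/

section Radical

variable {R S : Type*} [Ring R] [Ring S]

/-- If `J(S)` contracts to the set of nilpotent elements of `R`, then `N(R)` is that set. -/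
theorem mem_upperNilRadical_iff_of_map_mem_jacobson (ι : R →+* S)
    (h : ∀ r, ι r ∈ Ring.jacobson S ↔ IsNilpotent r) (r : R) :
    r ∈ upperNilRadical R ↔ IsNilpotent r := by
  have h2 : ((Ring.jacobson S).comap ι).IsTwoSided := inferInstance
  constructor
  · intro hr
    have hle : upperNilRadical R ≤ (Ring.jacobson S).comap ι :=
      sSup_le fun I hI x hx => (h x).2 (hI.2 x hx)
    exact (h r).1 (hle hr)
  · intro hr
    exact (le_sSup ⟨h2, fun a ha => (h a).1 ha⟩ :
      (Ring.jacobson S).comap ι ≤ upperNilRadical R) ((h r).2 hr)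

theorem Polynomial.isNilpotent_of_C_mem_jacobson {r : R}
    (hr : Polynomial.C r ∈ Ring.jacobson R[X]) : IsNilpotent r := by
  obtain ⟨z, hz⟩ := Ring.mem_jacobson_iff_exists_left_inverse.1 hr Polynomial.X
  rw [Polynomial.X_mul] at hz
  exact Polynomial.isNilpotent_of_mul_one_sub_C_mul_X hz

theorem LaurentPolynomial.isNilpotent_of_C_mem_jacobson {r : R}
    (hr : C r ∈ Ring.jacobson R[T;T⁻¹]) : IsNilpotent r := by
  obtain ⟨z, hz⟩ := Ring.mem_jacobson_iff_exists_left_inverse.1 hr (T 1)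
  rw [T_mul] at hz
  exact LaurentPolynomial.isNilpotent_of_mul_one_sub_C_mul_T hz

theorem Polynomial.jacobson_le_polynomialsWithCoeffsIn
    (hN : ∀ r : R, r ∈ upperNilRadical R ↔ IsNilpotent r)
    (hcomm : ∀ a b : R ⧸ upperNilRadical R, a * b = b * a) :
    Ring.jacobson R[X] ≤ polynomialsWithCoeffsIn (upperNilRadical R) := by
  intro f hf n
  let _ : CommRing (R ⧸ upperNilRadical R) := { (inferInstance : Ring _) with mul_comm := hcomm }
  let q := Ideal.Quotient.mk (upperNilRadical R)
  -- The factor `X` shifts all coefficients of `f` to positive degree, where a unit over a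
  -- commutative ring has nilpotent coefficients.
  have hu := Ring.isUnit_one_sub_of_mem_jacobson ((Ring.jacobson R[X]).mul_mem_left
    Polynomial.X hf)
  have hu' := hu.map (Polynomial.mapRingHom q)
  have := (Polynomial.isUnit_iff_coeff_isUnit_isNilpotent.1 hu').2 (n + 1) (Nat.succ_ne_zero n)
  have h2 : IsNilpotent (-(q (f.coeff n))) := by
    convert! this using 1
    simp [Polynomial.coeff_one]
  rw [isNilpotent_neg_iff] at h2
  obtain ⟨k, hk⟩ := h2
  rw [← map_pow] at hk
  obtain ⟨m, hm⟩ := (hN _).1 (Ideal.Quotient.eq_zero_iff_mem.1 hk)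
  exact (hN _).2 ⟨k * m, by rw [pow_mul, hm]⟩

theorem quotient_upperNilRadical_comm
    (h : ∀ a b : R, a * b - b * a ∈ upperNilRadical R) (a b : R ⧸ upperNilRadical R) :
    a * b = b * a := by
  obtain ⟨a, rfl⟩ := Ideal.Quotient.mk_surjective a
  obtain ⟨b, rfl⟩ := Ideal.Quotient.mk_surjective b
  rw [← map_mul, ← map_mul, Ideal.Quotient.eq]
  exact h a b

theorem commutator_mem_of_quotient_comm {I : Ideal S} [I.IsTwoSided]
    (h : ∀ a b : S ⧸ I, a * b = b * a) (a b : S) : a * b - b * a ∈ I := by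
  rw [← Ideal.Quotient.eq, map_mul, map_mul]
  exact h _ _

/-- `J(R[x]) = N(R)[x]` and `R ⧸ N(R)` is commutative. -/
def JacobsonEqNilCoeffs (R : Type*) [Ring R] : Prop :=
  Ring.jacobson R[X] = polynomialsWithCoeffsIn (upperNilRadical R) ∧
    ∀ a b : R ⧸ upperNilRadical R, a * b = b * a

theorem JacobsonEqNilCoeffs.C_mem_jacobson (h : JacobsonEqNilCoeffs R) {r : R}
    (hr : r ∈ upperNilRadical R) : Polynomial.C r ∈ Ring.jacobson R[X] := by
  rw [h.1]
  intro n
  rw [Polynomial.coeff_C]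
  split_ifs
  · exact hr
  · exact Submodule.zero_mem _

theorem JacobsonEqNilCoeffs.isCommModJacobson (h : JacobsonEqNilCoeffs R) :
    IsCommModJacobson R[X] :=
  Polynomial.isCommModJacobson fun a b =>
    h.C_mem_jacobson (commutator_mem_of_quotient_comm h.2 a b)

theorem IsCommModJacobson.jacobsonEqNilCoeffs (h : IsCommModJacobson R[X]) :
    JacobsonEqNilCoeffs R := by
  have hC : ∀ r : R, Polynomial.C r ∈ Ring.jacobson R[X] ↔ IsNilpotent r := fun r =>
    ⟨Polynomial.isNilpotent_of_C_mem_jacobson, fun hr =>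
      h.isLeftQuasiDuo.mem_jacobson_of_isNilpotent (hr.map Polynomial.C)⟩
  have hN := mem_upperNilRadical_iff_of_map_mem_jacobson Polynomial.C hC
  have hcomm := quotient_upperNilRadical_comm (R := R) fun a b =>
    (hN _).2 ((hC _).1 (by rw [map_sub, map_mul, map_mul]; exact h _ _))
  refine ⟨le_antisymm (Polynomial.jacobson_le_polynomialsWithCoeffsIn hN hcomm) ?_, hcomm⟩
  intro f hf
  rw [f.as_sum_support_C_mul_X_pow]
  exact Submodule.sum_mem _ fun n _ =>
    Ideal.mul_mem_right _ _ ((hC _).2 ((hN _).1 (hf n)))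

theorem IsCommModJacobson.jacobsonEqNilCoeffs_of_laurent (h : IsCommModJacobson R[T;T⁻¹]) :
    JacobsonEqNilCoeffs R := by
  have hC : ∀ r : R, LaurentPolynomial.C r ∈ Ring.jacobson R[T;T⁻¹] ↔ IsNilpotent r := fun r =>
    ⟨LaurentPolynomial.isNilpotent_of_C_mem_jacobson, fun hr =>
      h.isLeftQuasiDuo.mem_jacobson_of_isNilpotent (hr.map LaurentPolynomial.C)⟩
  have hN := mem_upperNilRadical_iff_of_map_mem_jacobson LaurentPolynomial.C hC
  have hcomm := quotient_upperNilRadical_comm (R := R) fun a b =>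
    (hN _).2 ((hC _).1 (by rw [map_sub, map_mul, map_mul]; exact h _ _))
  refine ⟨le_antisymm (Polynomial.jacobson_le_polynomialsWithCoeffsIn hN hcomm) ?_, hcomm⟩
  intro f hf
  rw [Ring.mem_jacobson_iff_exists_left_inverse]
  intro y
  have hyf := (polynomialsWithCoeffsIn (upperNilRadical R)).mul_mem_left y hf
  have hJ : Polynomial.toLaurent (y * f) ∈ Ring.jacobson R[T;T⁻¹] := by
    rw [(y * f).as_sum_support_C_mul_X_pow, map_sum]
    refine Submodule.sum_mem _ fun n _ => ?_
    rw [Polynomial.toLaurent_C_mul_X_pow]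
    exact Ideal.mul_mem_right _ _ ((hC _).2 ((hN _).1 (hyf n)))
  obtain ⟨z, hz⟩ := Ring.mem_jacobson_iff_exists_left_inverse.1 hJ 1
  -- The Laurent left inverse descends because `1 - y * f` has constant term one minus a nilpotent.
  refine LaurentPolynomial.exists_left_inverse_of_mul_toLaurent_eq_one (g := z) ?_
    (by rw [map_sub, map_one, ← one_mul (Polynomial.toLaurent _), hz])
  rw [Polynomial.coeff_sub, Polynomial.coeff_one_zero]
  exact ((hN _).1 (hyf 0)).isUnit_one_sub

end Radical

/-! ### Passing from `R[x]` to the Laurent ring by Nakayama -/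

section Laurent

variable {R : Type*} [Ring R]

namespace LaurentPolynomial

/-- The ring homomorphism `R[x] → R[T;T⁻¹]` sending `x` to `T + T⁻¹`. -/
noncomputable def evalTAddInv (R : Type*) [Ring R] : R[X] →+* R[T;T⁻¹] :=
  Polynomial.eval₂RingHom' C (T 1 + T (-1)) fun a =>
    ((commute_T 1 (C a)).add_left (commute_T (-1) (C a))).symm

theorem evalTAddInv_C (a : R) : evalTAddInv R (Polynomial.C a) = C a :=
  Polynomial.eval₂_C _ _

theorem evalTAddInv_X : evalTAddInv R Polynomial.X = T 1 + T (-1) :=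
  Polynomial.eval₂_X _ _

/-- With `s = T + T⁻¹`, the relations `T² = sT - 1` and `T⁻¹ = s - T` show that `1` and `T` span all
powers of `T` over `R[s]`. -/
theorem exists_evalTAddInv_T (n : ℤ) :
    ∃ p q : R[X], T n = evalTAddInv R p + evalTAddInv R q * T 1 := by
  have hT : ∀ f : R[T;T⁻¹], T 1 * f = f * T 1 := T_mul 1
  have h1 : (T 1 : R[T;T⁻¹]) * T 1 = evalTAddInv R Polynomial.X * T 1 - 1 := by
    rw [evalTAddInv_X, add_mul, ← T_add (-1) 1, neg_add_cancel, T_zero, add_sub_cancel_right]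
  have h2 : (T (-1) : R[T;T⁻¹]) = evalTAddInv R Polynomial.X - T 1 := by
    rw [evalTAddInv_X, add_sub_cancel_left]
  induction n using Int.induction_on with
  | zero => exact ⟨1, 0, by simp⟩
  | succ n ih =>
    obtain ⟨p, q, h⟩ := ih
    refine ⟨-q, p + q * Polynomial.X, ?_⟩
    rw [T_add, h, add_mul, mul_assoc, h1, map_neg, map_add, map_mul]
    noncomm_ring
  | pred n ih =>
    obtain ⟨p, q, h⟩ := ih
    refine ⟨p * Polynomial.X + q, -p, ?_⟩
    rw [sub_eq_add_neg, T_add, h, add_mul, mul_assoc, ← T_add 1 (-1), add_neg_cancel, T_zero,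
      mul_one, h2, map_add, map_mul, map_neg]
    noncomm_ring

theorem exists_evalTAddInv (f : R[T;T⁻¹]) :
    ∃ p q : R[X], f = evalTAddInv R p + evalTAddInv R q * T 1 := by
  induction f using LaurentPolynomial.induction_on' with
  | add f g hf hg =>
    obtain ⟨p, q, rfl⟩ := hf
    obtain ⟨p', q', rfl⟩ := hg
    exact ⟨p + p', q + q', by rw [map_add, map_add, add_mul]; abel⟩
  | C_mul_T n a =>
    obtain ⟨p, q, h⟩ := exists_evalTAddInv_T (R := R) n
    refine ⟨Polynomial.C a * p, Polynomial.C a * q, ?_⟩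
    rw [h, map_mul, map_mul, evalTAddInv_C, mul_add, mul_assoc]

end LaurentPolynomial

open LaurentPolynomial in
-- For a maximal left ideal `M`, the quotient `V` by `M` is finitely generated over `R[x]` through
-- `x ↦ T + T⁻¹`. If `r` were not in `M`, then `V = J(R[x]) V`, and Nakayama would force `V = 0`.
theorem JacobsonEqNilCoeffs.C_mem_jacobson_laurent (h : JacobsonEqNilCoeffs R) {r : R}
    (hr : r ∈ upperNilRadical R) : LaurentPolynomial.C r ∈ Ring.jacobson R[T;T⁻¹] := by
  rw [Ring.jacobson_eq_sInf_isMaximal, Submodule.mem_sInf]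
  intro M hM
  by_contra hrM
  obtain ⟨t, m, hm, ht⟩ := Ideal.IsMaximal.exists_inv hM hrM
  let _ : Module R[X] (R[T;T⁻¹] ⧸ M) := Module.compHom _ (evalTAddInv R)
  have hsmul : ∀ (p : R[X]) (f : R[T;T⁻¹]),
      p • (M.mkQ f) = M.mkQ (evalTAddInv R p * f) := fun _ _ => rfl
  have hfg : (⊤ : Submodule R[X] (R[T;T⁻¹] ⧸ M)).FG := by
    refine Submodule.fg_def.2 ⟨{M.mkQ 1, M.mkQ (T 1)}, Set.toFinite _, ?_⟩
    rw [eq_top_iff]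
    rintro v -
    obtain ⟨f, rfl⟩ := M.mkQ_surjective v
    obtain ⟨p, q, rfl⟩ := exists_evalTAddInv f
    rw [Submodule.mem_span_pair]
    exact ⟨p, q, by rw [hsmul, hsmul, mul_one, map_add]⟩
  have hmem : ∀ f : R[T;T⁻¹], M.mkQ (f * C r) ∈
      Ring.jacobson R[X] • (⊤ : Submodule R[X] (R[T;T⁻¹] ⧸ M)) := by
    intro f
    induction f using LaurentPolynomial.induction_on' with
    | add f g hf hg =>
      rw [add_mul, map_add]
      exact Submodule.add_mem _ hf hg
    | C_mul_T n a =>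
      rw [mul_assoc, T_mul, ← mul_assoc, ← map_mul, ← evalTAddInv_C, ← hsmul]
      exact Submodule.smul_mem_smul
        (h.C_mem_jacobson ((upperNilRadical R).mul_mem_left a hr)) Submodule.mem_top
  have htop : (⊤ : Submodule R[X] (R[T;T⁻¹] ⧸ M)) = ⊥ := by
    refine hfg.eq_bot_of_le_jacobson_smul ?_
    rintro v -
    obtain ⟨f, rfl⟩ := M.mkQ_surjective v
    -- Multiply `t * C r + m = 1` on the left by `f`; the term `f * m` dies modulo `M`.
    have e : M.mkQ f = M.mkQ (f * t * C r) := by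
      nth_rewrite 1 [← mul_one f, ← ht]
      rw [mul_add, map_add, mul_assoc, add_eq_left, Submodule.mkQ_apply,
        Submodule.Quotient.mk_eq_zero]
      exact Ideal.mul_mem_left M f hm
    rw [e]
    exact hmem _
  apply hM.ne_top
  rw [Ideal.eq_top_iff_one, ← Submodule.Quotient.mk_eq_zero M, ← Submodule.mkQ_apply,
    ← Submodule.mem_bot R[X], ← htop]
  exact Submodule.mem_top

theorem JacobsonEqNilCoeffs.isCommModJacobson_laurent (h : JacobsonEqNilCoeffs R) :
    IsCommModJacobson R[T;T⁻¹] :=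
  LaurentPolynomial.isCommModJacobson fun a b =>
    h.C_mem_jacobson_laurent (commutator_mem_of_quotient_comm h.2 a b)

end Laurent

theorem mainTheorem3 (R : Type*) [Ring R] :
    (IsRightQuasiDuo R[X] ↔ IsRightQuasiDuo R[T;T⁻¹]) ∧
    (IsRightQuasiDuo R[T;T⁻¹] ↔
      (Ring.jacobson R[X] = polynomialsWithCoeffsIn (upperNilRadical R) ∧
        ∀ a b : R ⧸ upperNilRadical R, a * b = b * a)) ∧
    (IsLeftQuasiDuo R[X] ↔ IsLeftQuasiDuo R[T;T⁻¹]) ∧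
    (IsLeftQuasiDuo R[T;T⁻¹] ↔
      (Ring.jacobson R[X] = polynomialsWithCoeffsIn (upperNilRadical R) ∧
        ∀ a b : R ⧸ upperNilRadical R, a * b = b * a)) ∧
    (IsRightQuasiDuo R[X] ↔ IsLeftQuasiDuo R[X]) ∧
    (IsLeftQuasiDuo R[X] ↔ ∀ f g : R[X] ⧸ Ring.jacobson R[X], f * g = g * f) := by
  have hP : IsCommModJacobson R[X] ↔ JacobsonEqNilCoeffs R :=
    ⟨IsCommModJacobson.jacobsonEqNilCoeffs, JacobsonEqNilCoeffs.isCommModJacobson⟩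
  have hL : IsCommModJacobson R[T;T⁻¹] ↔ JacobsonEqNilCoeffs R :=
    ⟨IsCommModJacobson.jacobsonEqNilCoeffs_of_laurent,
      JacobsonEqNilCoeffs.isCommModJacobson_laurent⟩
  rw [Polynomial.isLeftQuasiDuo_iff, Polynomial.isRightQuasiDuo_iff,
    LaurentPolynomial.isLeftQuasiDuo_iff, LaurentPolynomial.isRightQuasiDuo_iff]
  refine ⟨hP.trans hL.symm, hL, hP.trans hL.symm, hL, Iff.rfl, fun h f g => ?_,
    commutator_mem_of_quotient_comm⟩
  obtain ⟨f, rfl⟩ := Ideal.Quotient.mk_surjective f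
  obtain ⟨g, rfl⟩ := Ideal.Quotient.mk_surjective g
  rw [← map_mul, ← map_mul, Ideal.Quotient.eq]
  exact h f g
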